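/- Fix a set of propositional variables. A clause is a finite set of literals (read as their disjunction), a CNF formula is a finite set of clauses, and a $2$CNF formula is a CNF formula all of whose clauses have at most two literals. A sub-formula of $\Phi$ is a subset of its clauses. A resolution step with matching variable $x$ derives from $\alpha\vee x$ and $\neg x\vee\beta$ the clause $\alpha\vee\beta$. A formula is in Var-ROR if the empty clause can be derived from it by a finite (possibly empty) sequence of resolution steps, each applied to clauses of the formula or previously derived clauses, in which every variable is used at most once as a matching variable; it is minimally Var-ROR if it is in Var-ROR and no proper sub-formula is in Var-ROR. A formula is minimal unsatisfiable if it is unsatisfiable and every proper sub-formula is satisfiable; $\mathrm{MU}(1)$ is the set of minimal unsatisfiable formulas in which the number of clauses minus the number of variables occurring in the formula equals $1$. Theorem. Let $\Phi$ be a $2$CNF formula. Then 1. $\Phi$ is in Var-ROR if and only if there is a sub-formula $\Phi'\subseteq\Phi$ with $\Phi'\in\mathrm{MU}(1)$; 2. $\Phi$ is minimally Var-ROR if and only if $\Phi\in\mathrm{MU}(1)$. -/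

import Mathlib

namespace VarROR

/-- A literal over the variables `V`: `(x, true)` is `x`, and `(x, false)` is `¬ x`. -/
abbrev Literal (V : Type*) := V × Bool

/-- A clause is a finite disjunction of literals, written as a set; `∅` is the empty clause. -/
abbrev Clause (V : Type*) := Finset (Literal V)

/-- A formula in CNF is a finite set of clauses. -/
abbrev Formula (V : Type*) := Finset (Clause V)

section

variable {V : Type*}

/-- Every clause has at most two literals. -/
def Is2CNF (Φ : Formula V) : Prop :=
  ∀ C ∈ Φ, C.card ≤ 2

/-- Some truth assignment makes a literal true in every clause. -/
def Satisfiable (Φ : Formula V) : Prop :=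
  ∃ v : V → Bool, ∀ C ∈ Φ, ∃ l ∈ C, v l.1 = l.2

/-- Unsatisfiable, while every proper sub-formula is satisfiable. -/
def MinimalUnsat (Φ : Formula V) : Prop :=
  ¬ Satisfiable Φ ∧ ∀ Ψ : Formula V, Ψ ⊂ Φ → Satisfiable Ψ

variable [DecidableEq V]

/-- The variables that occur in the formula. -/
def vars (Φ : Formula V) : Finset V :=
  Φ.biUnion fun C => C.image Prod.fst

/-- Number of clauses minus number of variables. -/
def deficiency (Φ : Formula V) : ℤ :=
  (Φ.card : ℤ) - ((vars Φ).card : ℤ)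

/-- The set MU(`k`) of minimal unsatisfiable formulas of deficiency `k`. -/
def MU (k : ℤ) : Set (Formula V) :=
  {Φ | MinimalUnsat Φ ∧ deficiency Φ = k}

/-- `R` is the resolvent of `C = α ∨ x` and `D = ¬ x ∨ β` with matching variable `x`,
that is, `R = α ∨ β`. -/
def IsResolvent (x : V) (C D R : Clause V) : Prop :=
  (x, true) ∈ C ∧ (x, false) ∈ D ∧ R = C.erase (x, true) ∪ D.erase (x, false)

/-- `Derivation Φ xs π`: the clause `π` is generated from the clauses of `Φ` by a sequence of
resolution steps whose matching variables are, in this order, the entries of `xs`. The parents of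
each step are clauses of `Φ` or resolvents of earlier steps; clauses may be used repeatedly. -/
inductive Derivation : Formula V → List V → Clause V → Prop
  | initial {Φ : Formula V} {π : Clause V} (h : π ∈ Φ) : Derivation Φ [] π
  | step {Φ : Formula V} {x : V} {xs : List V} {C D R π : Clause V} (hC : C ∈ Φ) (hD : D ∈ Φ)
      (hR : IsResolvent x C D R) (h : Derivation (insert R Φ) xs π) : Derivation Φ (x :: xs) π

/-- There is a resolution refutation (a derivation of the empty clause) in which every variable is
used at most once as a matching variable. -/
def IsVarROR (Φ : Formula V) : Prop :=
  ∃ xs : List V, xs.Nodup ∧ Derivation Φ xs ∅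

/-- In Var-ROR, while no proper sub-formula is in Var-ROR. -/
def MinimallyVarROR (Φ : Formula V) : Prop :=
  IsVarROR Φ ∧ ∀ Ψ : Formula V, Ψ ⊂ Φ → ¬ IsVarROR Ψ

end

end VarROR

namespace VarROR

section

variable {V : Type*}

/-! Resolving on a variable and undoing that step both preserve MU(1), provided the variable
disappears: clause count and variable count change together. Undoing a refutation from its last
step, starting at `{∅}`, replaces each resolvent in the current core by its parents. Read-once
variables make each matching variable new to the core, so the result is a sub-formula in MU(1)
(`Derivation.exists_MU`); clause width plays no role. Conversely, counting literal occurrences shows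
that a 2CNF formula in MU(1) with a variable has one occurring once with each sign
(`exists_card_clausesWith_eq_one`). Resolving it away (`resolve_mem_MU`) and inducting on the number
of variables gives a refutation. -/

theorem Satisfiable.mono {Φ Ψ : Formula V} (h : Satisfiable Ψ) (hs : Φ ⊆ Ψ) : Satisfiable Φ := by
  obtain ⟨v, hv⟩ := h
  exact ⟨v, fun C hC => hv C (hs hC)⟩

theorem Is2CNF.mono {Φ Ψ : Formula V} (h : Is2CNF Ψ) (hs : Φ ⊆ Ψ) : Is2CNF Φ :=
  fun C hC => h C (hs hC)

variable [DecidableEq V]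

theorem minimalUnsat_iff_erase {Φ : Formula V} :
    MinimalUnsat Φ ↔ ¬ Satisfiable Φ ∧ ∀ C ∈ Φ, Satisfiable (Φ.erase C) := by
  refine and_congr_right fun _ => ⟨fun h C hC => h _ (Finset.erase_ssubset hC), fun h Ψ hΨ => ?_⟩
  obtain ⟨C, hC, hΨC⟩ := Finset.ssubset_iff_exists_subset_erase.1 hΨ
  exact (h C hC).mono hΨC

theorem mem_vars {Φ : Formula V} {x : V} : x ∈ vars Φ ↔ ∃ C ∈ Φ, ∃ b, (x, b) ∈ C := by
  simp [vars]

theorem fst_mem_vars {Φ : Formula V} {C : Clause V} {l : Literal V} (hC : C ∈ Φ) (hl : l ∈ C) :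
    l.1 ∈ vars Φ :=
  mem_vars.2 ⟨C, hC, l.2, hl⟩

/-! ### Single resolution steps and derivations -/

theorem IsResolvent.subset {x : V} {C D R : Clause V} (h : IsResolvent x C D R) {l : Literal V}
    (hl : l ∈ R) : l ∈ C ∨ l ∈ D := by
  obtain ⟨-, -, rfl⟩ := h
  rw [Finset.mem_union, Finset.mem_erase, Finset.mem_erase] at hl
  tauto

theorem IsResolvent.mem_of_left {x : V} {C D R : Clause V} (h : IsResolvent x C D R)
    {l : Literal V} (hl : l ∈ C) (hx : l ≠ (x, true)) : l ∈ R := by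
  rw [h.2.2]
  exact Finset.mem_union_left _ (Finset.mem_erase.2 ⟨hx, hl⟩)

theorem IsResolvent.mem_of_right {x : V} {C D R : Clause V} (h : IsResolvent x C D R)
    {l : Literal V} (hl : l ∈ D) (hx : l ≠ (x, false)) : l ∈ R := by
  rw [h.2.2]
  exact Finset.mem_union_right _ (Finset.mem_erase.2 ⟨hx, hl⟩)

/-- Soundness of a resolution step. -/
theorem IsResolvent.exists_true {x : V} {C D R : Clause V} (h : IsResolvent x C D R) {v : V → Bool}
    (hC : ∃ l ∈ C, v l.1 = l.2) (hD : ∃ l ∈ D, v l.1 = l.2) : ∃ l ∈ R, v l.1 = l.2 := by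
  obtain ⟨l, hl, hvl⟩ := hC
  obtain ⟨m, hm, hvm⟩ := hD
  by_cases hlx : l = (x, true)
  · refine ⟨m, h.mem_of_right hm ?_, hvm⟩
    rintro rfl
    subst hlx
    simp_all
  · exact ⟨l, h.mem_of_left hl hlx, hvl⟩

/-- An assignment of a resolvent that does not contain the matching variable can be changed at the
matching variable so that it satisfies both parents. -/
theorem IsResolvent.exists_update {x : V} {C D R : Clause V} (h : IsResolvent x C D R)
    (hx : ∀ b, (x, b) ∉ R) {v : V → Bool} (hR : ∃ l ∈ R, v l.1 = l.2) :
    ∃ b, (∃ l ∈ C, Function.update v x b l.1 = l.2) ∧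
      ∃ l ∈ D, Function.update v x b l.1 = l.2 := by
  obtain ⟨l, hl, hvl⟩ := hR
  have hlx : l.1 ≠ x := by
    rintro rfl
    exact hx l.2 hl
  rcases h.subset hl with hC | hD
  · exact ⟨false, ⟨l, hC, by rwa [Function.update_of_ne hlx]⟩, (x, false), h.2.1, by simp⟩
  · exact ⟨true, ⟨(x, true), h.1, by simp⟩, l, hD, by rwa [Function.update_of_ne hlx]⟩

theorem exists_true_update {C : Clause V} {x : V} (hx : ∀ b, (x, b) ∉ C) {v : V → Bool} (b : Bool)
    (h : ∃ l ∈ C, v l.1 = l.2) : ∃ l ∈ C, Function.update v x b l.1 = l.2 := by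
  obtain ⟨l, hl, hvl⟩ := h
  refine ⟨l, hl, ?_⟩
  rwa [Function.update_of_ne]
  rintro rfl
  exact hx l.2 hl

theorem Derivation.mono {Φ Ψ : Formula V} {xs : List V} {π : Clause V} (h : Derivation Φ xs π)
    (hs : Φ ⊆ Ψ) : Derivation Ψ xs π := by
  induction h generalizing Ψ with
  | initial h => exact .initial (hs h)
  | step hC hD hR _ ih => exact .step (hs hC) (hs hD) hR (ih (Finset.insert_subset_insert _ hs))

/-- Guarantees that a variable already resolved away is never matched again. -/
theorem Derivation.mem_vars {Φ : Formula V} {xs : List V} {π : Clause V} (h : Derivation Φ xs π) :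
    ∀ x ∈ xs, x ∈ vars Φ := by
  induction h with
  | initial h => simp
  | step hC hD hR _ ih =>
    intro y hy
    rcases List.mem_cons.1 hy with rfl | hy
    · exact fst_mem_vars hC hR.1
    · obtain ⟨E, hE, b, hb⟩ := VarROR.mem_vars.1 (ih y hy)
      rcases Finset.mem_insert.1 hE with rfl | hE
      · rcases hR.subset hb with hb | hb
        · exact fst_mem_vars hC hb
        · exact fst_mem_vars hD hb
      · exact fst_mem_vars hE hb

/-! ### From refutations to MU(1) -/

theorem singleton_empty_mem_MU : ({∅} : Formula V) ∈ MU 1 := by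
  refine ⟨minimalUnsat_iff_erase.2 ⟨?_, ?_⟩, by simp [deficiency, vars]⟩
  · rintro ⟨v, hv⟩
    simpa using hv ∅ (by simp)
  · intro C hC
    rw [Finset.mem_singleton.1 hC]
    exact ⟨fun _ => true, by simp⟩

theorem vars_unresolve {Φ : Formula V} {x : V} {C D R : Clause V} (hR : IsResolvent x C D R)
    (hRΦ : R ∈ Φ) : vars (insert C (insert D (Φ.erase R))) = insert x (vars Φ) := by
  ext y
  rw [Finset.mem_insert, mem_vars]
  constructor
  · rintro ⟨E, hE, b, hb⟩
    refine or_iff_not_imp_left.2 fun hy => ?_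
    have hne : ∀ c, (y, b) ≠ (x, c) := fun c hc => hy (congrArg Prod.fst hc)
    simp only [Finset.mem_insert] at hE
    rcases hE with rfl | rfl | hE
    · exact fst_mem_vars hRΦ (hR.mem_of_left hb (hne _))
    · exact fst_mem_vars hRΦ (hR.mem_of_right hb (hne _))
    · exact fst_mem_vars (Finset.mem_of_mem_erase hE) hb
  · rintro (rfl | hy)
    · exact ⟨C, by simp, true, hR.1⟩
    · obtain ⟨E, hE, b, hb⟩ := mem_vars.1 hy
      by_cases hER : E = R
      · subst hER
        rcases hR.subset hb with hb | hb
        · exact ⟨C, by simp, b, hb⟩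
        · exact ⟨D, by simp, b, hb⟩
      · exact ⟨E, by simp [hE, hER], b, hb⟩

/-- Replacing a clause of a formula in MU(1) by two parents of which it is the resolvent, with a
matching variable that is new to the formula, gives a formula in MU(1). -/
theorem unresolve_mem_MU {Φ : Formula V} (hΦ : Φ ∈ MU 1) {x : V} (hx : x ∉ vars Φ)
    {C D R : Clause V} (hR : IsResolvent x C D R) (hRΦ : R ∈ Φ) :
    insert C (insert D (Φ.erase R)) ∈ MU 1 := by
  obtain ⟨hmu, hdef⟩ := hΦ
  obtain ⟨hunsat, hmin⟩ := minimalUnsat_iff_erase.1 hmu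
  have hxΦ : ∀ E ∈ Φ, ∀ b, (x, b) ∉ E := fun E hE b hb => hx (mem_vars.2 ⟨E, hE, b, hb⟩)
  have hDC : (x, false) ∉ C := fun h => hxΦ R hRΦ false (hR.mem_of_left h (by simp))
  have hne : C ≠ D := by
    rintro rfl
    exact hDC hR.2.1
  have hCΦ : C ∉ Φ := fun h => hxΦ C h true hR.1
  have hDΦ : D ∉ Φ := fun h => hxΦ D h false hR.2.1
  refine ⟨minimalUnsat_iff_erase.2 ⟨?_, ?_⟩, ?_⟩
  · rintro ⟨v, hv⟩
    refine hunsat ⟨v, fun E hE => ?_⟩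
    by_cases hER : E = R
    · subst hER
      exact hR.exists_true (hv C (by simp)) (hv D (by simp))
    · exact hv E (by simp [hE, hER])
  · intro E hE
    obtain ⟨v, hv⟩ : Satisfiable (Φ.erase R) := hmin R hRΦ
    have key : ∀ b, ∀ F ∈ Φ.erase R, ∃ l ∈ F, Function.update v x b l.1 = l.2 := fun b F hF =>
      exists_true_update (hxΦ F (Finset.mem_of_mem_erase hF)) b (hv F hF)
    simp only [Finset.mem_insert] at hE
    rcases hE with rfl | rfl | hE
    -- With one parent gone, the new variable is free to satisfy the other.
    · refine ⟨Function.update v x false, fun F hF => ?_⟩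
      simp only [Finset.mem_erase, Finset.mem_insert] at hF
      rcases hF.2 with rfl | rfl | hF'
      · exact absurd rfl hF.1
      · exact ⟨_, hR.2.1, by simp⟩
      · exact key _ F (Finset.mem_erase.2 hF')
    · refine ⟨Function.update v x true, fun F hF => ?_⟩
      simp only [Finset.mem_erase, Finset.mem_insert] at hF
      rcases hF.2 with rfl | rfl | hF'
      · exact ⟨_, hR.1, by simp⟩
      · exact absurd rfl hF.1
      · exact key _ F (Finset.mem_erase.2 hF')
    -- Here `R` keeps a true literal, which satisfies one parent; `x` is set to satisfy the other.
    · obtain ⟨hER, hE⟩ := Finset.mem_erase.1 hE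
      obtain ⟨w, hw⟩ := hmin E hE
      obtain ⟨b, hbC, hbD⟩ := hR.exists_update (hxΦ R hRΦ)
        (hw R (Finset.mem_erase.2 ⟨hER.symm, hRΦ⟩))
      refine ⟨Function.update w x b, fun F hF => ?_⟩
      simp only [Finset.mem_erase, Finset.mem_insert] at hF
      rcases hF.2 with rfl | rfl | hF'
      · exact hbC
      · exact hbD
      · exact exists_true_update (hxΦ F hF'.2) b (hw F (Finset.mem_erase.2 ⟨hF.1, hF'.2⟩))
  · have h1 : (insert C (insert D (Φ.erase R))).card = Φ.card + 1 := by
      rw [Finset.card_insert_of_notMem (by simp [hne, hCΦ]),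
        Finset.card_insert_of_notMem (by simp [hDΦ]), Finset.card_erase_add_one hRΦ]
    have h2 : (vars (insert C (insert D (Φ.erase R)))).card = (vars Φ).card + 1 := by
      rw [vars_unresolve hR hRΦ, Finset.card_insert_of_notMem hx]
    unfold deficiency at hdef ⊢
    rw [h1, h2]
    push_cast
    omega

/-- A refutation that uses every variable at most once as matching variable rests on a sub-formula
in MU(1) all of whose variables are matching variables. -/
theorem Derivation.exists_MU {Φ : Formula V} {xs : List V} {π : Clause V} (h : Derivation Φ xs π)
    (hπ : π = ∅) (hxs : xs.Nodup) :
    ∃ Ψ : Formula V, Ψ ⊆ Φ ∧ Ψ ∈ MU (V := V) 1 ∧ ∀ x ∈ vars Ψ, x ∈ xs := by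
  induction h with
  | initial h =>
    subst hπ
    exact ⟨{∅}, by simpa using h, singleton_empty_mem_MU, by simp [vars]⟩
  | @step Φ x xs C D R π hC hD hR _ ih =>
    obtain ⟨hx, hxs⟩ := List.nodup_cons.1 hxs
    obtain ⟨Ψ, hsub, hMU, hvars⟩ := ih hπ hxs
    -- If the core avoids `R`, this step of the refutation is superfluous.
    by_cases hRΨ : R ∈ Ψ
    · refine ⟨_, ?_, unresolve_mem_MU hMU (fun h => hx (hvars x h)) hR hRΨ, ?_⟩
      · rw [Finset.insert_subset_iff, Finset.insert_subset_iff]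
        exact ⟨hC, hD, Finset.subset_insert_iff.1 hsub⟩
      · rw [vars_unresolve hR hRΨ]
        intro y hy
        rcases Finset.mem_insert.1 hy with rfl | hy
        · exact List.mem_cons_self
        · exact List.mem_cons_of_mem _ (hvars y hy)
    · exact ⟨Ψ, (Finset.subset_insert_iff_of_notMem hRΨ).1 hsub, hMU,
        fun y hy => List.mem_cons_of_mem _ (hvars y hy)⟩

/-! ### Counting occurrences in minimal unsatisfiable formulas -/

/-- A minimal unsatisfiable formula contains no tautological clause. -/
theorem MinimalUnsat.not_mem_of_mem {Φ : Formula V} (h : MinimalUnsat Φ) {C : Clause V}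
    (hC : C ∈ Φ) {x : V} {b : Bool} (hb : (x, b) ∈ C) : (x, !b) ∉ C := by
  intro hb'
  obtain ⟨hunsat, hmin⟩ := minimalUnsat_iff_erase.1 h
  obtain ⟨v, hv⟩ := hmin C hC
  refine hunsat ⟨v, fun E hE => ?_⟩
  by_cases hEC : E = C
  · subst hEC
    by_cases hvx : v x = b
    · exact ⟨_, hb, hvx⟩
    · exact ⟨_, hb', Bool.eq_not_of_ne hvx⟩
  · exact hv E (Finset.mem_erase.2 ⟨hEC, hE⟩)

/-- In a minimal unsatisfiable formula every variable occurs with both signs. -/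
theorem MinimalUnsat.exists_mem {Φ : Formula V} (h : MinimalUnsat Φ) {x : V} (hx : x ∈ vars Φ)
    (b : Bool) : ∃ C ∈ Φ, (x, b) ∈ C := by
  by_contra! hno
  obtain ⟨hunsat, hmin⟩ := minimalUnsat_iff_erase.1 h
  obtain ⟨C, hC, c, hc⟩ := mem_vars.1 hx
  have hcb : ∀ E ∈ Φ, ∀ d, (x, d) ∈ E → d = !b := fun E hE d hd =>
    Bool.eq_not_of_ne (fun hdb => hno E hE (hdb ▸ hd))
  obtain ⟨v, hv⟩ := hmin C hC
  -- Pure literal rule: this value of `x` satisfies every clause containing `x`, among them the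
  -- omitted `C`.
  refine hunsat ⟨Function.update v x (!b), fun E hE => ?_⟩
  by_cases hEx : ∃ d, (x, d) ∈ E
  · obtain ⟨d, hd⟩ := hEx
    exact ⟨_, hd, by simp [hcb E hE d hd]⟩
  · push Not at hEx
    refine exists_true_update hEx _ (hv E (Finset.mem_erase.2 ⟨?_, hE⟩))
    rintro rfl
    exact hEx c hc

theorem MinimalUnsat.card_image_fst {Φ : Formula V} (h : MinimalUnsat Φ) {C : Clause V}
    (hC : C ∈ Φ) : (C.image Prod.fst).card = C.card := by
  refine Finset.card_image_of_injOn ?_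
  rintro ⟨x, b⟩ hb ⟨y, c⟩ hc hxy
  obtain rfl : x = y := hxy
  by_contra hne
  have : c = !b := Bool.eq_not_of_ne fun hcb => hne (by rw [hcb])
  exact h.not_mem_of_mem hC hb (this ▸ hc)

/-- The clauses of the formula that contain the literal. -/
def clausesWith (Φ : Formula V) (l : Literal V) : Finset (Clause V) :=
  Φ.filter fun C => l ∈ C

/-- Double counting of the incidences between literals and clauses. -/
theorem sum_card_clausesWith (Φ : Formula V) :
    ∑ x ∈ vars Φ, ((clausesWith Φ (x, true)).card + (clausesWith Φ (x, false)).card) =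
      ∑ C ∈ Φ, C.card := by
  have h1 : ∀ C ∈ Φ, C.card = ∑ l ∈ vars Φ ×ˢ Finset.univ, if l ∈ C then 1 else 0 := by
    intro C hC
    rw [Finset.sum_ite_mem, ← Finset.card_eq_sum_ones, Finset.inter_eq_right.2]
    intro l hl
    exact Finset.mem_product.2 ⟨fst_mem_vars hC hl, Finset.mem_univ _⟩
  rw [Finset.sum_congr rfl h1, Finset.sum_comm, Finset.sum_product]
  refine Finset.sum_congr rfl fun x _ => ?_
  simp [clausesWith]

theorem MinimalUnsat.clausesWith_card_pos {Φ : Formula V} (h : MinimalUnsat Φ) {x : V}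
    (hx : x ∈ vars Φ) (b : Bool) : 0 < (clausesWith Φ (x, b)).card := by
  obtain ⟨C, hC, hb⟩ := h.exists_mem hx b
  exact Finset.card_pos.2 ⟨C, Finset.mem_filter.2 ⟨hC, hb⟩⟩

/-- If all clauses contain two given variables, and one literal of the first variable
occurs in a single clause, then the formula is satisfiable. -/
theorem satisfiable_of_card_clausesWith_eq_one {Φ : Formula V} {x y : V} (hxy : x ≠ y)
    (hx : ∀ C ∈ Φ, ∃ b, (x, b) ∈ C) (hy : ∀ C ∈ Φ, ∃ b, (y, b) ∈ C) {b : Bool}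
    (hb : (clausesWith Φ (x, b)).card = 1) : Satisfiable Φ := by
  obtain ⟨C, hC⟩ := Finset.card_eq_one.1 hb
  have hmem : ∀ E, E ∈ Φ ∧ (x, b) ∈ E ↔ E = C := by
    intro E
    rw [← Finset.mem_singleton, ← hC, clausesWith, Finset.mem_filter]
  obtain ⟨c, hc⟩ := hy C ((hmem C).2 rfl).1
  -- The value of `x` satisfies every clause but `C`; the constant `c` makes the `y`-literal of `C`
  -- true.
  refine ⟨fun z => if z = x then !b else c, fun E hE => ?_⟩
  obtain ⟨d, hd⟩ := hx E hE
  by_cases hdb : d = b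
  · subst hdb
    obtain rfl := (hmem E).1 ⟨hE, hd⟩
    exact ⟨_, hc, by simp [hxy.symm]⟩
  · exact ⟨_, hd, by simp [Bool.eq_not_of_ne hdb]⟩

/-- A 2CNF formula in MU(1) in which some variable occurs has a variable that occurs exactly once
with each sign. -/
theorem exists_card_clausesWith_eq_one {Φ : Formula V} (h2 : Is2CNF Φ) (hΦ : Φ ∈ MU 1)
    (hne : (vars Φ).Nonempty) :
    ∃ x, (clausesWith Φ (x, true)).card = 1 ∧ (clausesWith Φ (x, false)).card = 1 := by
  obtain ⟨hmu, hdef⟩ := hΦ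
  by_contra! hno
  have hocc : ∀ x ∈ vars Φ,
      3 ≤ (clausesWith Φ (x, true)).card + (clausesWith Φ (x, false)).card := by
    intro x hx
    have := hmu.clausesWith_card_pos hx true
    have := hmu.clausesWith_card_pos hx false
    have := hno x
    omega
  have hcard : Φ.card = (vars Φ).card + 1 := by
    unfold deficiency at hdef
    omega
  have hpos := hne.card_pos
  have hlow : (vars Φ).card * 3 ≤ ∑ C ∈ Φ, C.card := by
    rw [← sum_card_clausesWith, ← smul_eq_mul]
    exact Finset.card_nsmul_le_sum _ _ _ hocc
  have hup : ∑ C ∈ Φ, C.card ≤ Φ.card * 2 := by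
    rw [← smul_eq_mul]
    exact Finset.sum_le_card_nsmul _ _ _ h2
  have hup' : ∑ C ∈ Φ, C.card ≤ Φ.card * (vars Φ).card := by
    rw [← smul_eq_mul]
    refine Finset.sum_le_card_nsmul _ _ _ fun C hC => ?_
    rw [← hmu.card_image_fst hC]
    exact Finset.card_le_card (Finset.subset_biUnion_of_mem (fun C => C.image Prod.fst) hC)
  -- With `n` variables there are `n + 1` clauses, so `3n ≤ 2(n + 1)`.
  obtain hn | hn : (vars Φ).card = 1 ∨ (vars Φ).card = 2 := by omega
  -- Two clauses of at most one literal cannot hold three occurrences.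
  · rw [hcard, hn] at hup'
    omega
  -- Three clauses must hold six occurrences, so both bounds are tight.
  · have hC2 : ∀ C ∈ Φ, C.card = 2 := by
      refine (Finset.sum_eq_sum_iff_of_le h2).1 ?_
      rw [Finset.sum_const, smul_eq_mul]
      omega
    have himg : ∀ C ∈ Φ, ∀ z ∈ vars Φ, ∃ b, (z, b) ∈ C := by
      intro C hC z hz
      have : C.image Prod.fst = vars Φ :=
        Finset.eq_of_subset_of_card_le
          (Finset.subset_biUnion_of_mem (fun C => C.image Prod.fst) hC)
          (by rw [hmu.card_image_fst hC, hC2 C hC, hn])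
      rw [← this] at hz
      simpa using hz
    obtain ⟨x, y, hxy, hv⟩ := Finset.card_eq_two.1 hn
    have hx : x ∈ vars Φ := by simp [hv]
    have hy : y ∈ vars Φ := by simp [hv]
    have hsum : (clausesWith Φ (x, true)).card + (clausesWith Φ (x, false)).card = 3 := by
      have h := sum_card_clausesWith Φ
      rw [hv, Finset.sum_pair hxy] at h
      have := hocc x hx
      have := hocc y hy
      omega
    have := hmu.clausesWith_card_pos hx true
    have := hmu.clausesWith_card_pos hx false
    obtain ⟨b, hb⟩ : ∃ b, (clausesWith Φ (x, b)).card = 1 := by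
      rcases (by omega : (clausesWith Φ (x, true)).card = 1 ∨
        (clausesWith Φ (x, false)).card = 1) with h | h
      exacts [⟨_, h⟩, ⟨_, h⟩]
    exact hmu.1 (satisfiable_of_card_clausesWith_eq_one hxy (fun C hC => himg C hC x hx)
      (fun C hC => himg C hC y hy) hb)

/-! ### From MU(1) to refutations -/

/-- Resolving on a variable that occurs once with each sign, and deleting the parents, keeps a
formula in MU(1). -/
theorem resolve_mem_MU {Φ : Formula V} (hΦ : Φ ∈ MU 1) {x : V} {C D R : Clause V} (hC : C ∈ Φ)
    (hD : D ∈ Φ) (hCx : ∀ E ∈ Φ, (x, true) ∈ E → E = C) (hDx : ∀ E ∈ Φ, (x, false) ∈ E → E = D)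
    (hR : IsResolvent x C D R) :
    insert R ((Φ.erase C).erase D) ∈ MU 1 ∧
      vars Φ = insert x (vars (insert R ((Φ.erase C).erase D))) ∧
      x ∉ vars (insert R ((Φ.erase C).erase D)) := by
  obtain ⟨hmu, hdef⟩ := hΦ
  set Φ₀ := (Φ.erase C).erase D with hΦ₀
  have hmem : ∀ E, E ∈ Φ₀ ↔ E ≠ D ∧ E ≠ C ∧ E ∈ Φ := by simp [hΦ₀]
  have hDC : D ≠ C := by
    rintro rfl
    exact hmu.not_mem_of_mem hC hR.1 hR.2.1
  have hx₀ : ∀ E ∈ Φ₀, ∀ b, (x, b) ∉ E := by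
    rintro E hE (_ | _) hb
    · exact ((hmem E).1 hE).1 (hDx E ((hmem E).1 hE).2.2 hb)
    · exact ((hmem E).1 hE).2.1 (hCx E ((hmem E).1 hE).2.2 hb)
  have hxR : ∀ b, (x, b) ∉ R := by
    intro b hb
    have h1 : (x, false) ∉ C := fun h => hDC (hDx C hC h).symm
    have h2 : (x, true) ∉ D := fun h => hDC (hCx D hD h)
    rw [hR.2.2] at hb
    cases b <;> simp [h1, h2] at hb
  have hxv : x ∉ vars (insert R Φ₀) := by
    intro h
    obtain ⟨E, hE, b, hb⟩ := mem_vars.1 h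
    rcases Finset.mem_insert.1 hE with rfl | hE
    · exact hxR b hb
    · exact hx₀ E hE b hb
  have hunsat : ¬ Satisfiable (insert R Φ₀) := by
    rintro ⟨v, hv⟩
    obtain ⟨b, hbC, hbD⟩ := hR.exists_update hxR (hv R (by simp))
    refine hmu.1 ⟨Function.update v x b, fun E hE => ?_⟩
    by_cases hEC : E = C
    · exact hEC ▸ hbC
    by_cases hED : E = D
    · exact hED ▸ hbD
    have hE₀ := (hmem E).2 ⟨hED, hEC, hE⟩
    exact exists_true_update (hx₀ E hE₀) b (hv E (Finset.mem_insert_of_mem hE₀))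
  have hsat₀ : Satisfiable Φ₀ :=
    ((minimalUnsat_iff_erase.1 hmu).2 C hC).mono (Finset.erase_subset _ _)
  -- The resolvent is a genuinely new clause, so the clause count drops by exactly one.
  have hRΦ₀ : R ∉ Φ₀ := fun h => hunsat (by rwa [Finset.insert_eq_of_mem h])
  have hback : insert C (insert D ((insert R Φ₀).erase R)) = Φ := by
    rw [Finset.erase_insert hRΦ₀, hΦ₀, Finset.insert_erase (Finset.mem_erase.2 ⟨hDC, hD⟩),
      Finset.insert_erase hC]
  have hvars : vars Φ = insert x (vars (insert R Φ₀)) := by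
    rw [← vars_unresolve hR (Finset.mem_insert_self R Φ₀), hback]
  refine ⟨⟨minimalUnsat_iff_erase.2 ⟨hunsat, fun E hE => ?_⟩, ?_⟩, hvars, hxv⟩
  · rcases Finset.mem_insert.1 hE with rfl | hE
    · exact hsat₀.mono (by rw [Finset.erase_insert hRΦ₀])
    · obtain ⟨hED, hEC, hEΦ⟩ := (hmem E).1 hE
      obtain ⟨v, hv⟩ := (minimalUnsat_iff_erase.1 hmu).2 E hEΦ
      refine ⟨v, fun F hF => ?_⟩
      obtain ⟨hFE, hF⟩ := Finset.mem_erase.1 hF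
      rcases Finset.mem_insert.1 hF with rfl | hF
      · exact hR.exists_true (hv C (Finset.mem_erase.2 ⟨hEC.symm, hC⟩))
          (hv D (Finset.mem_erase.2 ⟨hED.symm, hD⟩))
      · exact hv F (Finset.mem_erase.2 ⟨hFE, ((hmem F).1 hF).2.2⟩)
  · have h1 : Φ.card = (insert R Φ₀).card + 1 := by
      rw [Finset.card_insert_of_notMem hRΦ₀, hΦ₀,
        Finset.card_erase_add_one (Finset.mem_erase.2 ⟨hDC, hD⟩), Finset.card_erase_add_one hC]
    have h2 : (vars Φ).card = (vars (insert R Φ₀)).card + 1 := by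
      rw [hvars, Finset.card_insert_of_notMem hxv]
    unfold deficiency at hdef ⊢
    omega

/-- Each parent contributes at most one surviving literal, so width two persists. -/
theorem IsResolvent.card_le {x : V} {C D R : Clause V} (h : IsResolvent x C D R)
    (hC : C.card ≤ 2) (hD : D.card ≤ 2) : R.card ≤ 2 := by
  obtain ⟨hxC, hxD, rfl⟩ := h
  refine (Finset.card_union_le _ _).trans ?_
  rw [Finset.card_erase_of_mem hxC, Finset.card_erase_of_mem hxD]
  omega

theorem isVarROR_of_mem_MU {Φ : Formula V} (h2 : Is2CNF Φ) (hΦ : Φ ∈ MU 1) : IsVarROR Φ := by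
  induction hn : (vars Φ).card generalizing Φ with
  | zero =>
    -- Without variables, deficiency one leaves a single clause, necessarily empty.
    have hcard : Φ.card = 1 := by
      have := hΦ.2
      unfold deficiency at this
      omega
    obtain ⟨C, rfl⟩ := Finset.card_eq_one.1 hcard
    refine ⟨[], List.nodup_nil, .initial (Finset.mem_singleton.2 ?_)⟩
    refine (Finset.eq_empty_of_forall_notMem fun l hl => ?_).symm
    have := fst_mem_vars (Finset.mem_singleton_self C) hl
    simp [Finset.card_eq_zero.1 hn] at this
  | succ n ih =>
    obtain ⟨x, ht, hf⟩ := exists_card_clausesWith_eq_one h2 hΦ (Finset.card_pos.1 (by omega))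
    obtain ⟨C, hC⟩ := Finset.card_eq_one.1 ht
    obtain ⟨D, hD⟩ := Finset.card_eq_one.1 hf
    have hCmem : ∀ E, E ∈ Φ ∧ (x, true) ∈ E ↔ E = C := by
      intro E
      rw [← Finset.mem_singleton, ← hC, clausesWith, Finset.mem_filter]
    have hDmem : ∀ E, E ∈ Φ ∧ (x, false) ∈ E ↔ E = D := by
      intro E
      rw [← Finset.mem_singleton, ← hD, clausesWith, Finset.mem_filter]
    obtain ⟨hCΦ, hxC⟩ := (hCmem C).2 rfl
    obtain ⟨hDΦ, hxD⟩ := (hDmem D).2 rfl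
    have hR : IsResolvent x C D (C.erase (x, true) ∪ D.erase (x, false)) := ⟨hxC, hxD, rfl⟩
    obtain ⟨hMU, hvars, hx⟩ := resolve_mem_MU hΦ hCΦ hDΦ (fun E hE h => (hCmem E).1 ⟨hE, h⟩)
      (fun E hE h => (hDmem E).1 ⟨hE, h⟩) hR
    have hsub : (Φ.erase C).erase D ⊆ Φ :=
      (Finset.erase_subset _ _).trans (Finset.erase_subset _ _)
    obtain ⟨xs, hxs, hder⟩ := ih
      (fun E hE => by
        rcases Finset.mem_insert.1 hE with rfl | hE
        · exact hR.card_le (h2 C hCΦ) (h2 D hDΦ)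
        · exact h2 E (hsub hE)) hMU
      (by rw [hvars, Finset.card_insert_of_notMem hx] at hn; omega)
    -- The remaining refutation matches only variables of the reduced formula, where `x` no longer
    -- occurs.
    exact ⟨x :: xs, List.nodup_cons.2 ⟨fun h => hx (hder.mem_vars x h), hxs⟩,
      .step hCΦ hDΦ hR (hder.mono (Finset.insert_subset_insert _ hsub))⟩

theorem IsVarROR.exists_MU {Φ : Formula V} (h : IsVarROR Φ) :
    ∃ Ψ : Formula V, Ψ ⊆ Φ ∧ Ψ ∈ MU (V := V) 1 := by
  obtain ⟨xs, hxs, hder⟩ := h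
  obtain ⟨Ψ, hsub, hMU, -⟩ := hder.exists_MU rfl hxs
  exact ⟨Ψ, hsub, hMU⟩

theorem IsVarROR.mono {Φ Ψ : Formula V} (h : IsVarROR Φ) (hs : Φ ⊆ Ψ) :
    IsVarROR Ψ := by
  obtain ⟨xs, hxs, hder⟩ := h
  exact ⟨xs, hxs, hder.mono hs⟩

end

end VarROR

theorem mainTheorem4 {V : Type*} [DecidableEq V] (Φ : VarROR.Formula V) (hΦ : VarROR.Is2CNF Φ) :
    (VarROR.IsVarROR Φ ↔ ∃ Φ' : VarROR.Formula V, Φ' ⊆ Φ ∧ Φ' ∈ VarROR.MU (V := V) 1) ∧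
      (VarROR.MinimallyVarROR Φ ↔ Φ ∈ VarROR.MU (V := V) 1) := by
  refine ⟨⟨fun h => h.exists_MU, ?_⟩, ?_, ?_⟩
  · rintro ⟨Ψ, hsub, hMU⟩
    exact (VarROR.isVarROR_of_mem_MU (hΦ.mono hsub) hMU).mono hsub
  · rintro ⟨h, hmin⟩
    obtain ⟨Ψ, hsub, hMU⟩ := h.exists_MU
    rcases hsub.eq_or_ssubset with rfl | hss
    · exact hMU
    · exact absurd (VarROR.isVarROR_of_mem_MU (hΦ.mono hsub) hMU) (hmin Ψ hss)
  · intro hMU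
    refine ⟨VarROR.isVarROR_of_mem_MU hΦ hMU, fun Ψ hΨ h => ?_⟩
    obtain ⟨Θ, hsub, hΘ⟩ := h.exists_MU
    exact hΘ.1.1 ((hMU.1.2 Ψ hΨ).mono hsub)
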